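/- Let $\overline{\mathbb Q}$ be an algebraic closure of $\mathbb Q$. Let $I$ (equations) and $K$ (unknowns) be finite index sets, and consider a homogeneous system $E$ $$\sum_{j\in K} q_{ij}\,\alpha_i^{x_j}=0\qquad(i\in I)$$ with bases $\alpha_i\in\overline{\mathbb Q}\setminus\{0\}$ (which may or may not be roots of unity), coefficients $q_{ij}\in\overline{\mathbb Q}$, and unknowns $x=(x_j)\in\mathbb Z^K$. Let $E'$ be the subsystem of the equations whose base $\alpha_i$ is not a root of unity, and let $N_E$ be the least common multiple of the orders of those $\alpha_i$ that are roots of unity ($N_E=1$ if there are none). For a solution $x$ of $E'$, a nonempty set $J\subseteq K$ is a *cluster* if $\sum_{j\in J}q_{ij}\alpha_i^{x_j}=0$ for every equation $i$ of $E'$ and no nonempty proper subset of $J$ has this property. The span of $J$ is $\max_{j\in J}x_j-\min_{j\in J}x_j$, and $\operatorname{mspan}(E')$ is the maximum of the spans of all clusters in all solutions of $E'$ ($0$ if there are none). A *cluster structure* for $x$ is a partition $\mathcal J$ of $K$ into clusters. Let $\Delta_J\in\{0,1\}^K$ be the indicator vector of $J$. Let $\mathcal T(E)$ be the set of pairs $(x,\mathcal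 J)$ where $x$ is a solution of $E$ with $0\le x_j<N_E+\operatorname{mspan}(E')$ for all $j$, and $\mathcal J$ is a cluster structure for $x$ with respect to $E'$. Then: 1. the spans of clusters in solutions of $E'$ are bounded (so $\operatorname{mspan}(E')$ is well defined), and $\mathcal T(E)$ is finite; 2. the set of all solutions of $E$ in $\mathbb Z^K$ equals $$\bigcup_{(x,\mathcal J)\in\mathcal T(E)}\bigl(x+N_E\cdot\operatorname{span}_{\mathbb Z}\{\Delta_J: J\in\mathcal J\}\bigr);$$ 3. hence the set of all solutions of $E$ is semilinear, that is, a finite union of cosets of subgroups of $\mathbb Z^K$. The same holds for non-homogeneous systems $E$: $\sum_{j\in K} q_{ij}\alpha_i^{x_j}=c_i$ ($i\in I$) with $c_i\in\overline{\mathbb Q}$, in the following form. Let $N_E$ be as before, and let $E'$ be the subsystem, consisting of the equations whose base is not a root of unity, of the associated homogeneous system $\sum_{j\in K} q_{ij}\alpha_i^{x_j}-c_i\alpha_i^{x_0}=0$ with an auxiliary unknown $x_0$. Let $\mathcal T(E)$ be the set of pairs $(x,\mathcal J)$ where $x\in\mathbb Z^K$ is a solution of $E$, $\mathcal J$ is a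 cluster structure for $(0,x)$ (that is, $x_0=0$) with respect to $E'$, and, with $J_0\in\mathcal J$ the cluster containing the index $0$, $0\le x_j<N_E+\operatorname{mspan}(E')$ for $j\in K\setminus J_0$ and $|x_j|\le\operatorname{mspan}(E')$ for $j\in K\cap J_0$. Then the spans of clusters in solutions of $E'$ are bounded, $\mathcal T(E)$ is finite, the set of all solutions of $E$ in $\mathbb Z^K$ equals $$\bigcup_{(x,\mathcal J)\in\mathcal T(E)}\bigl(x+N_E\cdot\operatorname{span}_{\mathbb Z}\{\Delta_J: J\in\mathcal J,\ J\neq J_0\}\bigr),$$ and it is semilinear. -/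

import Mathlib

/-- The maximum minus the minimum of the entries of `x` with index in `J`. -/
noncomputable def spanOf {κ : Type*} (x : κ → ℤ) (J : Finset κ) (hJ : J.Nonempty) : ℤ :=
  J.sup' hJ x - J.inf' hJ x

/-- The indicator vector `Δ_J ∈ {0,1}^κ` of a set of indices. -/
noncomputable def deltaVec {κ : Type*} (J : Finset κ) : κ → ℤ :=
  Set.indicator (J : Set κ) 1

/-- A subset of `ℤ^κ` that is a finite union of cosets of subgroups of `ℤ^κ`. -/
def IsCosetSemilinear {κ : Type*} (S : Set (κ → ℤ)) : Prop :=
  ∃ (n : ℕ) (δ : Fin n → κ → ℤ) (A : Fin n → AddSubgroup (κ → ℤ)),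
    S = ⋃ i, {y | ∃ a ∈ A i, y = δ i + a}

/-- A homogeneous system `∑ j, q i j * α i ^ x j = 0` (one equation for each `i : ι`) in integer
unknowns `x j`, `j : κ`, with nonzero algebraic bases `α i` and algebraic coefficients `q i j`.
The bases may or may not be roots of unity. -/
structure HomExpSystem (ι κ : Type*) where
  base : ι → AlgebraicClosure ℚ
  base_ne_zero : ∀ i, base i ≠ 0
  coeff : ι → κ → AlgebraicClosure ℚ

namespace HomExpSystem

variable {ι κ : Type*}

/-- The subset `J` of the unknowns contributes `0` to every equation. -/
def VanishesOn (E : HomExpSystem ι κ) (x : κ → ℤ) (J : Finset κ) : Prop :=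
  ∀ i, ∑ j ∈ J, E.coeff i j * E.base i ^ x j = 0

/-- `x` solves the system. -/
def IsSolution [Fintype κ] (E : HomExpSystem ι κ) (x : κ → ℤ) : Prop :=
  ∀ i, ∑ j, E.coeff i j * E.base i ^ x j = 0

/-- The subsystem of those equations whose base is not a root of unity. -/
def nonTorsion (E : HomExpSystem ι κ) : HomExpSystem {i : ι // ¬ IsOfFinOrder (E.base i)} κ where
  base i := E.base i
  base_ne_zero i := E.base_ne_zero i
  coeff i := E.coeff i

/-- A cluster: a minimal nonempty set of unknowns on which every equation vanishes. -/
def IsCluster (E : HomExpSystem ι κ) (x : κ → ℤ) (J : Finset κ) : Prop :=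
  J.Nonempty ∧ E.VanishesOn x J ∧ ∀ J' : Finset κ, J' ⊂ J → J'.Nonempty → ¬ E.VanishesOn x J'

/-- A cluster structure: a partition of the set of all unknowns into clusters. -/
def IsClusterStructure (E : HomExpSystem ι κ) (x : κ → ℤ) (𝒥 : Finset (Finset κ)) : Prop :=
  (∀ J ∈ 𝒥, E.IsCluster x J) ∧ (𝒥 : Set (Finset κ)).PairwiseDisjoint id ∧ ∀ j, ∃ J ∈ 𝒥, j ∈ J

/-- All spans of clusters in solutions of the system. -/
def clusterSpans [Fintype κ] (E : HomExpSystem ι κ) : Set ℤ :=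
  {n | ∃ (x : κ → ℤ) (J : Finset κ) (h : E.IsCluster x J), E.IsSolution x ∧ n = spanOf x J h.1}

/-- The maximum span of the system (`0` if there is no cluster; that the maximum exists
otherwise is the boundedness of `clusterSpans`). -/
noncomputable def mspan [Fintype κ] (E : HomExpSystem ι κ) : ℤ :=
  sSup E.clusterSpans

open scoped Classical in
/-- The least common multiple of the orders of those bases that are roots of unity
(`1` if there are none). -/
noncomputable def period [Fintype ι] (E : HomExpSystem ι κ) : ℕ :=
  (Finset.univ.filter fun i => IsOfFinOrder (E.base i)).lcm fun i => orderOf (E.base i)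

/-- The coset `x + N_E · span_ℤ {Δ_J : J ∈ 𝒥}`. -/
def shiftCoset [Fintype ι] (E : HomExpSystem ι κ) (x : κ → ℤ) (𝒥 : Finset (Finset κ)) :
    Set (κ → ℤ) :=
  {y | ∃ β : Finset κ → ℤ, y = x + ∑ J ∈ 𝒥, ((E.period : ℤ) * β J) • deltaVec J}

/-- The pairs of a solution `x` in the box `0 ≤ x j < N_E + mspan` and a cluster structure
for `x`, where clusters and `mspan` refer to the equations whose base is no root of unity. -/
def boundedPairs [Fintype ι] [Fintype κ] (E : HomExpSystem ι κ) :
    Set ((κ → ℤ) × Finset (Finset κ)) :=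
  {p | E.IsSolution p.1 ∧ E.nonTorsion.IsClusterStructure p.1 p.2 ∧
    ∀ j, 0 ≤ p.1 j ∧ p.1 j < E.period + E.nonTorsion.mspan}

end HomExpSystem

/-- A system `∑ j, q i j * α i ^ x j = c i` with arbitrary algebraic right-hand sides `c i`. -/
structure ExpSystem (ι κ : Type*) extends HomExpSystem ι κ where
  const : ι → AlgebraicClosure ℚ

namespace ExpSystem

variable {ι κ : Type*}

/-- `x` solves the system. -/
def IsSolution [Fintype κ] (E : ExpSystem ι κ) (x : κ → ℤ) : Prop :=
  ∀ i, ∑ j, E.coeff i j * E.base i ^ x j = E.const i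

/-- The associated homogeneous system
`∑ j, q i j * α i ^ x j - c i * α i ^ x₀ = 0`; the index `none` is that of the auxiliary
unknown `x₀`. -/
noncomputable def homogenize (E : ExpSystem ι κ) : HomExpSystem ι (Option κ) where
  base := E.base
  base_ne_zero := E.base_ne_zero
  coeff i j := j.elim (-E.const i) (E.coeff i)

/-- The vector `x` together with the value `x₀ = 0` of the auxiliary unknown. -/
def extendZero (x : κ → ℤ) : Option κ → ℤ :=
  fun j => j.elim 0 x

open scoped Classical in
/-- The coset obtained from `x` by shifting the clusters that do not contain the auxiliary
index by multiples of `N_E`. -/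
def shiftCoset [Fintype ι] (E : ExpSystem ι κ) (x : κ → ℤ) (𝒥 : Finset (Finset (Option κ))) :
    Set (κ → ℤ) :=
  {y | ∃ β : Finset (Option κ) → ℤ, ∀ j, y j = x j +
    ∑ J ∈ 𝒥.filter (fun J => none ∉ J), (E.period : ℤ) * β J * deltaVec J (some j)}

/-- The pairs of a solution `x` and a cluster structure for `(0, x)`, with respect to the
equations of the associated homogeneous system whose base is no root of unity, such that
`0 ≤ x j < N_E + mspan` for each `j` in a cluster that may be shifted and `|x j| ≤ mspan`
for each `j` in the cluster of the auxiliary index. -/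
def boundedPairs [Fintype ι] [Fintype κ] (E : ExpSystem ι κ) :
    Set ((κ → ℤ) × Finset (Finset (Option κ))) :=
  {p | E.IsSolution p.1 ∧ E.homogenize.nonTorsion.IsClusterStructure (extendZero p.1) p.2 ∧
    ∀ J ∈ p.2, ∀ j : κ, some j ∈ J →
      (none ∉ J → 0 ≤ p.1 j ∧ p.1 j < E.period + E.homogenize.nonTorsion.mspan) ∧
      (none ∈ J → |p.1 j| ≤ E.homogenize.nonTorsion.mspan)}

end ExpSystem

/-! A base `α` that is not a root of unity has absolute value above `1` at some place of a number
field containing the data of its equation. If the largest exponents in a vanishing sum lie close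
together and far above the rest, their part must vanish: otherwise it is too large at that place for
the rest to cancel. In a cluster no nonempty proper part vanishes in all equations, so descending
through its exponents one meets only bounded gaps (`exists_gap`, `exists_top_group`), and spans are
bounded.

Translating a cluster by `c` multiplies its sums by `α ^ c`, so clusters move independently; moves
by multiples of `N_E` also fix each term whose base is a root of unity. Hence each solution can be
moved, cluster by cluster, into the finite box. The inhomogeneous case pins `x₀ = 0` and leaves its
cluster in place. -/

/-- In a number field, a nonzero element that is not a root of unity has absolute value
greater than `1` at some place. -/
theorem NumberField.exists_absoluteValue_one_lt {K : Type*} [Field K] [NumberField K] {a : K}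
    (ha : a ≠ 0) (h : ¬ IsOfFinOrder a) : ∃ v : AbsoluteValue K ℝ, 1 < v a := by
  by_contra! hv
  -- The finite places make `a` integral; with the infinite places, Kronecker's theorem then makes
  -- it a root of unity.
  have hint : a ∈ (algebraMap (NumberField.RingOfIntegers K) K).range := by
    refine IsDedekindDomain.HeightOneSpectrum.mem_integers_of_valuation_le_one K a fun w => ?_
    have := hv (NumberField.HeightOneSpectrum.adicAbv K w)
    rw [NumberField.HeightOneSpectrum.adicAbv_def] at this
    exact (WithZeroMulInt.toNNReal_le_one_iff (NumberField.HeightOneSpectrum.one_lt_absNorm_nnreal w)).1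
      (mod_cast this)
  obtain ⟨b, rfl⟩ := hint
  obtain ⟨n, hn, hpow⟩ := NumberField.Embeddings.pow_eq_one_of_norm_le_one K ℂ ha
    (NumberField.RingOfIntegers.isIntegral_coe b) fun φ => hv (NumberField.place φ)
  exact h (isOfFinOrder_iff_pow_eq_one.2 ⟨n, hn, hpow⟩)

open scoped Classical in
/-- If `1 < v a`, then in a vanishing sum `∑ q j * a ^ x j` a group of summands whose exponents
lie within `s` of each other, and above all others by a sufficiently large gap, vanishes. -/
theorem AbsoluteValue.exists_gap {K κ : Type*} [Field K] [Fintype κ] (v : AbsoluteValue K ℝ)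
    {a : K} (ha : 1 < v a) (q : κ → K) (s : ℤ) :
    ∃ g : ℤ, ∀ (x : κ → ℤ) (T J : Finset κ), T ⊆ J → ∑ j ∈ J, q j * a ^ x j = 0 →
      (∀ j ∈ T, ∀ k ∈ T, x j - x k ≤ s) → (∀ j ∈ T, ∀ k ∈ J \ T, g < x j - x k) →
      ∑ j ∈ T, q j * a ^ x j = 0 := by
  have ha0 : a ≠ 0 := v.ne_zero_iff.1 (by linarith)
  set C : ℝ := ∑ j, v (q j)
  -- The possible sizes of a group once its least exponent is normalised to `0`. They are finitely
  -- many, so the positive ones are bounded below by some `ε`.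
  set V : Set ℝ := (fun p : Finset κ × (κ → ℤ) => v (∑ j ∈ p.1, q j * a ^ p.2 j)) ''
    (Set.univ ×ˢ Set.pi Set.univ fun _ => Set.Icc 0 s)
  have hV : V.Finite :=
    (Set.finite_univ.prod (Set.Finite.pi' fun _ => Set.finite_Icc 0 s)).image _ |>.subset
      (Set.image_mono (Set.prod_mono le_rfl fun d hd j => hd j trivial))
  obtain ⟨ε, hε, hεV⟩ : ∃ ε : ℝ, 0 < ε ∧ ∀ r ∈ V, 0 < r → ε ≤ r := by
    rcases (V ∩ Set.Ioi 0).eq_empty_or_nonempty with h | h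
    · exact ⟨1, one_pos, fun r hr hr0 => (h.subset ⟨hr, hr0⟩).elim⟩
    · obtain ⟨ε, hε, hmin⟩ := (hV.inter_of_left _).exists_minimal h
      refine ⟨ε, hε.2, fun r hr hr0 => ?_⟩
      by_contra! hlt
      exact absurd (hmin ⟨hr, hr0⟩ hlt.le) (not_le.2 hlt)
  obtain ⟨g, hg⟩ := pow_unbounded_of_one_lt (C / ε) ha
  refine ⟨g, fun x T J hTJ hJ hs hgap => ?_⟩
  rcases T.eq_empty_or_nonempty with rfl | hT
  · simp
  obtain ⟨m, hm, hmin⟩ := T.exists_min_image x hT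
  -- The value `0` off `T` only keeps `d` in the box that defines `V`.
  set d : κ → ℤ := fun j => if j ∈ T then x j - x m else 0
  have hd : ∑ j ∈ T, q j * a ^ x j = a ^ x m * ∑ j ∈ T, q j * a ^ d j := by
    rw [Finset.mul_sum]
    refine Finset.sum_congr rfl fun j hj => ?_
    simp only [d, hj, if_true, zpow_sub₀ ha0]
    field_simp
  by_contra hne
  have hs0 : 0 ≤ s := by simpa using hs m hm m hm
  have hpos : 0 < v (∑ j ∈ T, q j * a ^ d j) := by
    refine v.pos fun h0 => hne ?_
    rw [hd, h0, mul_zero]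
  have hεle : ε ≤ v (∑ j ∈ T, q j * a ^ d j) := by
    refine hεV _ ⟨(T, d), ⟨trivial, fun j _ => ?_⟩, rfl⟩ hpos
    by_cases hj : j ∈ T
    · simpa [d, hj] using And.intro (hmin j hj) (hs j hj m hm)
    · simpa [d, hj] using hs0
  have hrest : v (∑ j ∈ T, q j * a ^ x j) = v (∑ j ∈ J \ T, q j * a ^ x j) := by
    rw [← Finset.sum_sdiff hTJ] at hJ
    rw [eq_neg_of_add_eq_zero_left hJ, v.map_neg]
  -- The group has size at least `ε * v a ^ x m`, the rest at most `C * v a ^ (x m - g)`; this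
  -- contradicts `C / ε < v a ^ g`.
  have hle : v (∑ j ∈ J \ T, q j * a ^ x j) ≤ C * v a ^ (x m - g) := by
    calc _ ≤ ∑ j ∈ J \ T, v (q j * a ^ x j) := v.sum_le _ _
      _ ≤ ∑ j ∈ J \ T, v (q j) * v a ^ (x m - g) := by
          refine Finset.sum_le_sum fun j hj => ?_
          rw [v.map_mul, map_zpow₀]
          refine mul_le_mul_of_nonneg_left (zpow_le_zpow_right₀ ha.le ?_) (v.nonneg _)
          linarith [hgap m hm j hj]
      _ = (∑ j ∈ J \ T, v (q j)) * v a ^ (x m - g) := (Finset.sum_mul ..).symm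
      _ ≤ _ := by
          refine mul_le_mul_of_nonneg_right ?_ (by positivity)
          exact Finset.sum_le_sum_of_subset_of_nonneg (Finset.subset_univ _)
            fun j _ _ => v.nonneg _
  rw [← hrest, hd, v.map_mul, map_zpow₀, zpow_sub₀ (by positivity), zpow_natCast] at hle
  have hp : 0 < v a ^ x m := by positivity
  have hpg : 0 < v a ^ g := by positivity
  have h1 : v a ^ x m * ε ≤ v a ^ x m * (C / v a ^ g) :=
    (mul_le_mul_of_nonneg_left hεle hp.le).trans (hle.trans_eq (by ring))
  have h2 := le_of_mul_le_mul_left h1 hp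
  rw [le_div_iff₀ hpg] at h2
  rw [div_lt_iff₀ hε] at hg
  linarith

-- The base and the finitely many coefficients generate a number field, where a suitable absolute
-- value exists.
open scoped Classical in
theorem AlgebraicClosure.exists_gap {κ : Type*} [Fintype κ] {a : AlgebraicClosure ℚ}
    (ha0 : a ≠ 0) (ha : ¬ IsOfFinOrder a) (q : κ → AlgebraicClosure ℚ) (s : ℤ) :
    ∃ g : ℤ, ∀ (x : κ → ℤ) (T J : Finset κ), T ⊆ J → ∑ j ∈ J, q j * a ^ x j = 0 →
      (∀ j ∈ T, ∀ k ∈ T, x j - x k ≤ s) → (∀ j ∈ T, ∀ k ∈ J \ T, g < x j - x k) →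
      ∑ j ∈ T, q j * a ^ x j = 0 := by
  set S : Set (AlgebraicClosure ℚ) := insert a (Set.range q)
  set K := IntermediateField.adjoin ℚ S
  have hfin : FiniteDimensional ℚ K := by
    have : Finite S := ((Set.finite_range q).insert a).to_subtype
    have : Algebra.IsAlgebraic ℚ (AlgebraicClosure ℚ) := by
      convert! AlgebraicClosure.isAlgebraic ℚ
    exact IntermediateField.finiteDimensional_adjoin fun x _ =>
      (Algebra.IsAlgebraic.isAlgebraic x).isIntegral
  have : NumberField K := { to_charZero := inferInstance, to_finiteDimensional := hfin }
  have hS : S ⊆ K := IntermediateField.subset_adjoin ℚ S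
  let a' : K := ⟨a, hS (Set.mem_insert _ _)⟩
  let q' : κ → K := fun j => ⟨q j, hS (Set.mem_insert_of_mem _ ⟨j, rfl⟩)⟩
  obtain ⟨v, hv⟩ := NumberField.exists_absoluteValue_one_lt (a := a')
    (fun h => ha0 (congrArg Subtype.val h))
    (fun h => ha ((algebraMap K (AlgebraicClosure ℚ)).toMonoidHom.isOfFinOrder h))
  have hcast (x : κ → ℤ) (T : Finset κ) :
      ∑ j ∈ T, q j * a ^ x j = algebraMap K (AlgebraicClosure ℚ) (∑ j ∈ T, q' j * a' ^ x j) := by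
    simp only [map_sum, map_mul, map_zpow₀]
    rfl
  obtain ⟨g, hg⟩ := v.exists_gap hv q' s
  refine ⟨g, fun x T J hTJ hJ hs hgap => ?_⟩
  rw [hcast] at hJ ⊢
  rw [hg x T J hTJ ((map_eq_zero _).1 hJ) hs hgap, map_zero]

/-! ### Boundedness of cluster spans -/

namespace HomExpSystem

variable {ι κ : Type*}

open scoped Classical in
theorem exists_gap [Finite ι] [Fintype κ] (E : HomExpSystem ι κ)
    (hE : ∀ i, ¬ IsOfFinOrder (E.base i)) (s : ℤ) :
    ∃ g : ℤ, ∀ (x : κ → ℤ) (T J : Finset κ), T ⊆ J → E.VanishesOn x J →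
      (∀ j ∈ T, ∀ k ∈ T, x j - x k ≤ s) → (∀ j ∈ T, ∀ k ∈ J \ T, g < x j - x k) →
      E.VanishesOn x T := by
  choose g hg using fun i =>
    AlgebraicClosure.exists_gap (E.base_ne_zero i) (hE i) (E.coeff i) s
  obtain ⟨M, hM⟩ := Finite.exists_le g
  exact ⟨M, fun x T J hTJ hJ hs hgap i => hg i x T J hTJ (hJ i) hs fun j hj k hk =>
    (hM i).trans_lt (hgap j hj k hk)⟩

open scoped Classical in
/-- A cluster contains groups of any size of its largest exponents lying within a bounded distance
of each other. -/
theorem exists_top_group [Finite ι] [Fintype κ] (E : HomExpSystem ι κ)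
    (hE : ∀ i, ¬ IsOfFinOrder (E.base i)) (n : ℕ) :
    ∃ s : ℤ, ∀ (x : κ → ℤ) (J : Finset κ), E.IsCluster x J →
      ∃ T ⊆ J, T.Nonempty ∧ (n < T.card ∨ T = J) ∧ (∀ j ∈ T, ∀ k ∈ T, x j - x k ≤ s) ∧
        ∀ j ∈ T, ∀ k ∈ J \ T, x k ≤ x j := by
  induction n with
  | zero =>
    refine ⟨0, fun x J hJ => ?_⟩
    obtain ⟨m, hm, hmax⟩ := J.exists_max_image x hJ.1
    refine ⟨{m}, by simpa using hm, by simp, by simp, by simp, fun j hj k hk => ?_⟩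
    rw [Finset.mem_singleton.1 hj]
    exact hmax k (Finset.mem_sdiff.1 hk).1
  | succ n ih =>
    obtain ⟨s, hs⟩ := ih
    obtain ⟨g, hg⟩ := E.exists_gap hE s
    -- The next exponent below the group is within `g` of some member, hence within `s + g` of all;
    -- the maximum is needed as `g` may be negative.
    refine ⟨max s (s + g), fun x J hJ => ?_⟩
    obtain ⟨T, hTJ, hT, hn, hspan, htop⟩ := hs x J hJ
    by_cases hTe : T = J
    · exact ⟨T, hTJ, hT, .inr hTe, fun j hj k hk => (hspan j hj k hk).trans (le_max_left _ _), htop⟩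
    have hnv := hJ.2.2 T (Finset.ssubset_iff_subset_ne.2 ⟨hTJ, hTe⟩) hT
    have hex : ∃ j ∈ T, ∃ k ∈ J \ T, x j - x k ≤ g := by
      by_contra! hcon
      exact hnv (hg x T J hTJ hJ.2.1 hspan hcon)
    obtain ⟨j₀, hj₀, k₀, hk₀, hjk⟩ := hex
    obtain ⟨m, hm, hmax⟩ := (J \ T).exists_max_image x ⟨k₀, hk₀⟩
    have hmJ := Finset.mem_sdiff.1 hm
    refine ⟨insert m T, Finset.insert_subset hmJ.1 hTJ, Finset.insert_nonempty _ _, .inl ?_, ?_, ?_⟩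
    · rw [Finset.card_insert_of_notMem hmJ.2]
      have := hn.resolve_right hTe
      omega
    · have hs0 : 0 ≤ s := by simpa using hspan j₀ hj₀ j₀ hj₀
      intro j hj k hk
      rcases Finset.mem_insert.1 hj with rfl | hjT <;> rcases Finset.mem_insert.1 hk with rfl | hkT
      · exact le_max_of_le_left (by simpa using hs0)
      · exact le_max_of_le_left (by linarith [htop k hkT j hm])
      · exact le_max_of_le_right (by linarith [hspan j hjT j₀ hj₀, hmax k₀ hk₀])
      · exact le_max_of_le_left (hspan j hjT k hkT)
    · intro j hj k hk
      have hk' : k ∈ J \ T := Finset.sdiff_subset_sdiff le_rfl (Finset.subset_insert _ _) hk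
      rcases Finset.mem_insert.1 hj with rfl | hj
      · exact hmax k hk'
      · exact htop j hj k hk'

theorem bddAbove_clusterSpans [Finite ι] [Fintype κ] (E : HomExpSystem ι κ)
    (hE : ∀ i, ¬ IsOfFinOrder (E.base i)) : BddAbove E.clusterSpans := by
  -- No group has more than `Fintype.card κ` members, so the group must be the whole cluster.
  obtain ⟨s, hs⟩ := E.exists_top_group hE (Fintype.card κ)
  refine ⟨s, ?_⟩
  rintro _ ⟨x, J, hJ, -, rfl⟩
  obtain ⟨T, -, -, hn, hspan, -⟩ := hs x J hJ
  obtain rfl := hn.resolve_left (not_lt.2 (Finset.card_le_univ T))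
  obtain ⟨j, hj, hj'⟩ := T.exists_mem_eq_sup' hJ.1 x
  obtain ⟨k, hk, hk'⟩ := T.exists_mem_eq_inf' hJ.1 x
  rw [spanOf, hj', hk']
  exact hspan j hj k hk

theorem bddAbove_clusterSpans_nonTorsion [Finite ι] [Fintype κ] (E : HomExpSystem ι κ) :
    BddAbove E.nonTorsion.clusterSpans :=
  E.nonTorsion.bddAbove_clusterSpans fun i => i.2

end HomExpSystem

/-! ### Cluster structures and their shifts -/

namespace HomExpSystem

variable {ι κ : Type*}

theorem VanishesOn.sdiff [DecidableEq κ] {E : HomExpSystem ι κ} {x : κ → ℤ} {S J : Finset κ}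
    (hS : E.VanishesOn x S) (hJ : E.VanishesOn x J) (hJS : J ⊆ S) : E.VanishesOn x (S \ J) := by
  intro i
  have h := Finset.sum_sdiff hJS (f := fun j => E.coeff i j * E.base i ^ x j)
  rwa [hJ i, add_zero, hS i] at h

theorem VanishesOn.exists_isCluster {E : HomExpSystem ι κ} {x : κ → ℤ} {S : Finset κ}
    (hS : E.VanishesOn x S) (hne : S.Nonempty) : ∃ J ⊆ S, E.IsCluster x J := by
  induction S using Finset.strongInduction with
  | H S ih =>
    by_cases hmin : ∀ J' : Finset κ, J' ⊂ S → J'.Nonempty → ¬ E.VanishesOn x J'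
    · exact ⟨S, subset_rfl, hne, hS, hmin⟩
    · push Not at hmin
      obtain ⟨J', hJ', hne', hv⟩ := hmin
      obtain ⟨J, hJ, hc⟩ := ih J' hJ' hv hne'
      exact ⟨J, hJ.trans hJ'.subset, hc⟩

-- Removing a cluster from a vanishing set leaves a vanishing set, so clusters can be split off one
-- by one.
open scoped Classical in
theorem VanishesOn.exists_partition {E : HomExpSystem ι κ} {x : κ → ℤ} {S : Finset κ}
    (hS : E.VanishesOn x S) : ∃ 𝒥 : Finset (Finset κ), (∀ J ∈ 𝒥, E.IsCluster x J ∧ J ⊆ S) ∧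
      (𝒥 : Set (Finset κ)).PairwiseDisjoint id ∧ ∀ j ∈ S, ∃ J ∈ 𝒥, j ∈ J := by
  induction S using Finset.strongInduction with
  | H S ih =>
    rcases S.eq_empty_or_nonempty with rfl | hne
    · exact ⟨∅, by simp⟩
    obtain ⟨J, hJS, hJ⟩ := hS.exists_isCluster hne
    obtain ⟨𝒥, h1, h2, h3⟩ := ih (S \ J) (Finset.sdiff_ssubset hJS hJ.1) (hS.sdiff hJ.2.1 hJS)
    refine ⟨insert J 𝒥, ?_, ?_, fun j hj => ?_⟩
    · intro J' hJ'
      rcases Finset.mem_insert.1 hJ' with rfl | hJ'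
      · exact ⟨hJ, hJS⟩
      · exact ⟨(h1 J' hJ').1, (h1 J' hJ').2.trans Finset.sdiff_subset⟩
    · rw [Finset.coe_insert]
      refine h2.insert fun J' hJ' _ => ?_
      exact Finset.disjoint_sdiff.mono_right (h1 J' hJ').2
    · by_cases hjJ : j ∈ J
      · exact ⟨J, Finset.mem_insert_self _ _, hjJ⟩
      · obtain ⟨J', hJ', hj'⟩ := h3 j (Finset.mem_sdiff.2 ⟨hj, hjJ⟩)
        exact ⟨J', Finset.mem_insert_of_mem hJ', hj'⟩

theorem IsSolution.exists_isClusterStructure [Fintype κ] {E : HomExpSystem ι κ} {x : κ → ℤ}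
    (hx : E.IsSolution x) : ∃ 𝒥, E.IsClusterStructure x 𝒥 := by
  obtain ⟨𝒥, h1, h2, h3⟩ := VanishesOn.exists_partition (E := E) (S := Finset.univ) hx
  exact ⟨𝒥, fun J hJ => (h1 J hJ).1, h2, fun j => h3 j (Finset.mem_univ j)⟩

theorem IsSolution.nonTorsion [Fintype κ] {E : HomExpSystem ι κ} {x : κ → ℤ}
    (hx : E.IsSolution x) : E.nonTorsion.IsSolution x := fun i => hx i

theorem vanishesOn_congr_of_shift {E : HomExpSystem ι κ} {x y : κ → ℤ} {J : Finset κ} {c : ℤ}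
    (h : ∀ j ∈ J, y j = x j + c) : E.VanishesOn y J ↔ E.VanishesOn x J := by
  refine forall_congr' fun i => ?_
  have : ∑ j ∈ J, E.coeff i j * E.base i ^ y j
      = (∑ j ∈ J, E.coeff i j * E.base i ^ x j) * E.base i ^ c := by
    rw [Finset.sum_mul]
    refine Finset.sum_congr rfl fun j hj => ?_
    rw [h j hj, zpow_add₀ (E.base_ne_zero i), mul_assoc]
  rw [this, mul_eq_zero, or_iff_left (zpow_ne_zero _ (E.base_ne_zero i))]

theorem IsCluster.of_shift {E : HomExpSystem ι κ} {x y : κ → ℤ} {J : Finset κ} {c : ℤ}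
    (hJ : E.IsCluster x J) (h : ∀ j ∈ J, y j = x j + c) : E.IsCluster y J :=
  ⟨hJ.1, (vanishesOn_congr_of_shift h).2 hJ.2.1, fun J' hJ' hne hv =>
    hJ.2.2 J' hJ' hne ((vanishesOn_congr_of_shift fun j hj => h j (hJ'.subset hj)).1 hv)⟩

theorem IsClusterStructure.isSolution [Fintype κ] {E : HomExpSystem ι κ} {x : κ → ℤ}
    {𝒥 : Finset (Finset κ)} (h : E.IsClusterStructure x 𝒥) : E.IsSolution x := by
  classical
  intro i
  have hu : (Finset.univ : Finset κ) = 𝒥.biUnion id :=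
    (Finset.eq_univ_iff_forall.2 fun j => by simpa using h.2.2 j).symm
  rw [hu, Finset.sum_biUnion h.2.1]
  exact Finset.sum_eq_zero fun J hJ => (h.1 J hJ).2.1 i

theorem period_pos [Fintype ι] (E : HomExpSystem ι κ) : 0 < E.period := by
  classical
  refine Nat.pos_of_ne_zero fun h => ?_
  obtain ⟨i, hi, h0⟩ := Finset.lcm_eq_zero_iff.1 h
  exact (Finset.mem_filter.1 hi).2.orderOf_pos.ne' h0

theorem base_zpow_period_mul [Fintype ι] (E : HomExpSystem ι κ) {i : ι}
    (hi : IsOfFinOrder (E.base i)) (c : ℤ) : E.base i ^ ((E.period : ℤ) * c) = 1 := by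
  classical
  have h : orderOf (E.base i) ∣ E.period := Finset.dvd_lcm (by simpa using hi)
  rw [zpow_mul, zpow_natCast, orderOf_dvd_iff_pow_eq_one.1 h, one_zpow]

theorem IsClusterStructure.of_shift {F : HomExpSystem ι κ} {x y : κ → ℤ}
    {𝒥 : Finset (Finset κ)} {N : ℤ} {β : Finset κ → ℤ} (h : F.IsClusterStructure x 𝒥) (hy : ∀ J ∈ 𝒥, ∀ j ∈ J, y j = x j + N * β J) :
    F.IsClusterStructure y 𝒥 :=
  ⟨fun J hJ => (h.1 J hJ).of_shift (hy J hJ), h.2⟩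

/-- At roots of unity each term is unchanged; in the other equations each cluster still sums to
zero. -/
theorem IsSolution.of_shift [Fintype ι] [Fintype κ] {E : HomExpSystem ι κ} {x y : κ → ℤ}
    {𝒥 : Finset (Finset κ)} {β : Finset κ → ℤ} (hx : E.IsSolution x)
    (h : E.nonTorsion.IsClusterStructure x 𝒥)
    (hy : ∀ J ∈ 𝒥, ∀ j ∈ J, y j = x j + (E.period : ℤ) * β J) : E.IsSolution y := by
  intro i
  by_cases hi : IsOfFinOrder (E.base i)
  · rw [← hx i]
    refine Finset.sum_congr rfl fun j _ => ?_
    obtain ⟨J, hJ, hj⟩ := h.2.2 j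
    rw [hy J hJ j hj, zpow_add₀ (E.base_ne_zero i), E.base_zpow_period_mul hi, mul_one]
  · exact (h.of_shift hy).isSolution ⟨i, hi⟩

theorem sub_le_mspan [Fintype κ] {E : HomExpSystem ι κ} (hE : BddAbove E.clusterSpans)
    {x : κ → ℤ} {J : Finset κ} (hx : E.IsSolution x) (hJ : E.IsCluster x J) {j k : κ}
    (hj : j ∈ J) (hk : k ∈ J) : x j - x k ≤ E.mspan :=
  (sub_le_sub (Finset.le_sup' x hj) (Finset.inf'_le x hk)).trans
    (le_csSup hE ⟨x, J, hJ, hx, rfl⟩)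

end HomExpSystem

/-- Evaluation at `j` of a combination of the indicator vectors of disjoint sets. -/
theorem sum_mul_deltaVec {κ : Type*} {𝒥 : Finset (Finset κ)}
    (h : (𝒥 : Set (Finset κ)).PairwiseDisjoint id) (f : Finset κ → ℤ) {J : Finset κ} (hJ : J ∈ 𝒥)
    {j : κ} (hj : j ∈ J) : ∑ J' ∈ 𝒥, f J' * deltaVec J' j = f J := by
  rw [Finset.sum_eq_single_of_mem J hJ fun J' hJ' hne => ?_]
  · simp [deltaVec, hj]
  · have : j ∉ J' := fun hmem => Finset.disjoint_left.1 (h hJ' hJ hne) hmem hj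
    simp [deltaVec, this]

/-- A finite union of cosets of subgroups is semilinear. -/
theorem isCosetSemilinear_biUnion {κ α : Type*} {P : Set α} (hP : P.Finite)
    {C : α → Set (κ → ℤ)}
    (hC : ∀ p ∈ P, ∃ (δ : κ → ℤ) (A : AddSubgroup (κ → ℤ)), C p = {y | ∃ a ∈ A, y = δ + a}) :
    IsCosetSemilinear (⋃ p ∈ P, C p) := by
  choose! δ A hδ using hC
  have := hP.to_subtype
  obtain ⟨n, ⟨e⟩⟩ := Finite.exists_equiv_fin P
  refine ⟨n, fun i => δ (e.symm i), fun i => A (e.symm i), ?_⟩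
  rw [Set.biUnion_eq_iUnion, ← e.symm.surjective.iUnion_comp]
  exact Set.iUnion_congr fun i => hδ _ (e.symm i).2

theorem finite_of_bounded_fst {κ α : Type*} [Finite κ] [Finite α] {P : Set ((κ → ℤ) × α)}
    {a b : ℤ} (h : ∀ p ∈ P, ∀ j, a ≤ p.1 j ∧ p.1 j ≤ b) : P.Finite :=
  ((Set.Finite.pi' fun _ => Set.finite_Icc a b).prod Set.finite_univ).subset
    fun p hp => ⟨fun j => h p hp j, trivial⟩

/-! ### Homogeneous systems -/

namespace HomExpSystem

variable {ι κ : Type*} [Fintype ι] [Fintype κ]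

/-- A cluster can be moved by a multiple of the period so that it starts in `[0, N_E)`. -/
theorem IsCluster.exists_shift (E : HomExpSystem ι κ) {y : κ → ℤ} {J : Finset κ}
    (hy : E.IsSolution y) (hJ : E.nonTorsion.IsCluster y J) :
    ∃ b : ℤ, ∀ j ∈ J, 0 ≤ y j + (E.period : ℤ) * b ∧
      y j + (E.period : ℤ) * b < E.period + E.nonTorsion.mspan := by
  obtain ⟨m, hm, hmin⟩ := J.exists_min_image y hJ.1
  have hN : (0 : ℤ) < E.period := mod_cast E.period_pos
  -- This sends the least entry to its residue modulo `N_E`; the others exceed it by at most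
  -- `mspan`.
  refine ⟨-(y m / E.period), fun j hj => ?_⟩
  have h1 := Int.emod_add_mul_ediv (y m) E.period
  have h2 := Int.emod_nonneg (y m) hN.ne'
  have h3 := Int.emod_lt_of_pos (y m) hN
  have h4 := sub_le_mspan E.bddAbove_clusterSpans_nonTorsion hy.nonTorsion hJ hj hm
  have h5 := hmin j hj
  rw [mul_neg]
  constructor <;> linarith

theorem finite_boundedPairs (E : HomExpSystem ι κ) : E.boundedPairs.Finite :=
  finite_of_bounded_fst fun _ hp j => ⟨(hp.2.2 j).1, (hp.2.2 j).2.le⟩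

theorem setOf_isSolution (E : HomExpSystem ι κ) :
    {x | E.IsSolution x} = ⋃ p ∈ E.boundedPairs, E.shiftCoset p.1 p.2 := by
  ext y
  simp only [Set.mem_ofPred_eq, Set.mem_iUnion, exists_prop]
  constructor
  · intro hy
    obtain ⟨𝒥, h𝒥⟩ := hy.nonTorsion.exists_isClusterStructure
    choose! b hb using fun J hJ => IsCluster.exists_shift E hy (h𝒥.1 J hJ)
    set x : κ → ℤ := y + ∑ J ∈ 𝒥, ((E.period : ℤ) * b J) • deltaVec J with hxdef
    have hx (J) (hJ : J ∈ 𝒥) (j) (hj : j ∈ J) : x j = y j + (E.period : ℤ) * b J := by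
      simpa [hxdef] using sum_mul_deltaVec h𝒥.2.1 (fun J => (E.period : ℤ) * b J) hJ hj
    refine ⟨(x, 𝒥), ⟨hy.of_shift h𝒥 hx, h𝒥.of_shift hx, fun j => ?_⟩, -b, ?_⟩
    · obtain ⟨J, hJ, hj⟩ := h𝒥.2.2 j
      simpa only [hx J hJ j hj] using hb J hJ j hj
    · simp [hxdef]
  · rintro ⟨⟨x, 𝒥⟩, ⟨hx, h𝒥, -⟩, β, rfl⟩
    refine hx.of_shift h𝒥 (β := β) fun J hJ j hj => ?_
    simpa using sum_mul_deltaVec h𝒥.2.1 (fun J => (E.period : ℤ) * β J) hJ hj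

theorem isCosetSemilinear_setOf_isSolution (E : HomExpSystem ι κ) :
    IsCosetSemilinear {x | E.IsSolution x} := by
  rw [setOf_isSolution]
  refine isCosetSemilinear_biUnion E.finite_boundedPairs fun p _ => ?_
  let f : (Finset κ → ℤ) →+ (κ → ℤ) :=
    { toFun := fun β => ∑ J ∈ p.2, ((E.period : ℤ) * β J) • deltaVec J
      map_zero' := by simp
      map_add' := fun β γ => by simp [mul_add, add_smul, Finset.sum_add_distrib] }
  refine ⟨p.1, f.range, Set.ext fun y => ⟨?_, ?_⟩⟩
  · rintro ⟨β, rfl⟩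
    exact ⟨f β, ⟨β, rfl⟩, rfl⟩
  · rintro ⟨_, ⟨β, rfl⟩, rfl⟩
    exact ⟨β, rfl⟩

end HomExpSystem

/-! ### Inhomogeneous systems -/

namespace ExpSystem

variable {ι κ : Type*}

-- Freezing the cluster of `x₀` amounts to shifting it by `0`, so the homogeneous shift lemmas
-- apply.
open scoped Classical in
theorem sum_filter_mul_deltaVec (𝒥 : Finset (Finset (Option κ))) (N : ℤ)
    (β : Finset (Option κ) → ℤ) (j : Option κ) :
    ∑ J ∈ 𝒥.filter (fun J => none ∉ J), N * β J * deltaVec J j =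
      ∑ J ∈ 𝒥, N * (if none ∈ J then 0 else β J) * deltaVec J j := by
  rw [Finset.sum_filter]
  refine Finset.sum_congr rfl fun J _ => ?_
  split_ifs <;> simp_all

open scoped Classical in
/-- The effect on `(0, x)` of shifting the clusters without the auxiliary index. -/
theorem extendZero_shift {𝒥 : Finset (Finset (Option κ))}
    (h𝒥 : (𝒥 : Set (Finset (Option κ))).PairwiseDisjoint id) {N : ℤ}
    {β : Finset (Option κ) → ℤ} {x y : κ → ℤ}
    (hy : ∀ j, y j = x j + ∑ J ∈ 𝒥.filter (fun J => none ∉ J), N * β J * deltaVec J (some j))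
    (J : Finset (Option κ)) (hJ : J ∈ 𝒥) (j : Option κ) (hj : j ∈ J) :
    extendZero y j = extendZero x j + N * (if none ∈ J then 0 else β J) := by
  cases j with
  | none => simp [extendZero, hj]
  | some j =>
    have := sum_mul_deltaVec h𝒥 (fun J => N * (if none ∈ J then 0 else β J)) hJ hj
    rw [← this, ← sum_filter_mul_deltaVec]
    exact hy j

theorem isSolution_homogenize_iff [Fintype κ] (E : ExpSystem ι κ) (x : κ → ℤ) :
    E.homogenize.IsSolution (extendZero x) ↔ E.IsSolution x := by
  refine forall_congr' fun i => ?_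
  rw [Fintype.sum_option]
  simp only [homogenize, extendZero, Option.elim, zpow_zero, mul_one, neg_add_eq_zero]
  exact eq_comm

variable [Fintype ι] [Fintype κ]

theorem finite_boundedPairs (E : ExpSystem ι κ) : E.boundedPairs.Finite := by
  set M := E.homogenize.nonTorsion.mspan
  -- With `|M|` the sign of `mspan` is irrelevant.
  refine finite_of_bounded_fst (a := -|M|) (b := E.period + |M|) fun p hp j => ?_
  obtain ⟨J, hJ, hj⟩ := hp.2.1.2.2 (some j)
  have h := hp.2.2 J hJ j hj
  have hM := le_abs_self M
  have hM0 := abs_nonneg M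
  by_cases h0 : none ∈ J
  · have := abs_le.1 (h.2 h0)
    constructor <;> linarith [this.1, this.2]
  · have := h.1 h0
    constructor <;> linarith [this.1, this.2]

theorem setOf_isSolution (E : ExpSystem ι κ) :
    {x | E.IsSolution x} = ⋃ p ∈ E.boundedPairs, E.shiftCoset p.1 p.2 := by
  classical
  ext y
  simp only [Set.mem_ofPred_eq, Set.mem_iUnion, exists_prop]
  constructor
  · intro hy
    have hy' := (E.isSolution_homogenize_iff y).2 hy
    obtain ⟨𝒥, h𝒥⟩ := hy'.nonTorsion.exists_isClusterStructure
    choose! b hb using fun J hJ => HomExpSystem.IsCluster.exists_shift E.homogenize hy' (h𝒥.1 J hJ)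
    set x : κ → ℤ := fun j => y j +
      ∑ J ∈ 𝒥.filter (fun J => none ∉ J), (E.period : ℤ) * b J * deltaVec J (some j) with hxdef
    have hx := extendZero_shift h𝒥.2.1 (N := E.period) (β := b) (x := y) (y := x) fun _ => rfl
    have hx𝒥 := h𝒥.of_shift hx
    have hxs := hy'.of_shift h𝒥 hx
    refine ⟨(x, 𝒥), ⟨(E.isSolution_homogenize_iff x).1 hxs, hx𝒥,
      fun J hJ j hj => ⟨fun h0 => ?_, fun h0 => ?_⟩⟩, -b, fun j => ?_⟩
    · have h := hx J hJ (some j) hj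
      rw [if_neg h0] at h
      have h' := hb J hJ (some j) hj
      change x j = y j + _ at h
      simp only [h]
      exact h'
    -- Here `x₀ = 0` is itself an entry of the cluster, so the span bounds `x j` on both sides.
    · have hbdd := E.homogenize.bddAbove_clusterSpans_nonTorsion
      have h1 := HomExpSystem.sub_le_mspan hbdd hxs.nonTorsion (hx𝒥.1 J hJ) hj h0
      have h2 := HomExpSystem.sub_le_mspan hbdd hxs.nonTorsion (hx𝒥.1 J hJ) h0 hj
      change x j - 0 ≤ _ at h1
      change 0 - x j ≤ _ at h2
      exact abs_le.2 ⟨by linarith, by linarith⟩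
    · simp [hxdef]
  · rintro ⟨⟨x, 𝒥⟩, ⟨hx, h𝒥, -⟩, β, hβ⟩
    rw [← isSolution_homogenize_iff] at hx ⊢
    exact hx.of_shift h𝒥 (extendZero_shift h𝒥.2.1 hβ)

theorem isCosetSemilinear_setOf_isSolution (E : ExpSystem ι κ) :
    IsCosetSemilinear {x | E.IsSolution x} := by
  classical
  rw [setOf_isSolution]
  refine isCosetSemilinear_biUnion E.finite_boundedPairs fun p _ => ?_
  let f : (Finset (Option κ) → ℤ) →+ (κ → ℤ) :=
    { toFun := fun β j =>
        ∑ J ∈ p.2.filter (fun J => none ∉ J), (E.period : ℤ) * β J * deltaVec J (some j)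
      map_zero' := by ext; simp
      map_add' := fun β γ => by ext; simp [mul_add, add_mul, Finset.sum_add_distrib] }
  refine ⟨p.1, f.range, Set.ext fun y => ⟨?_, ?_⟩⟩
  · rintro ⟨β, hβ⟩
    exact ⟨f β, ⟨β, rfl⟩, funext hβ⟩
  · rintro ⟨_, ⟨β, rfl⟩, rfl⟩
    exact ⟨β, fun _ => rfl⟩

end ExpSystem

theorem mainTheorem9 {ι κ : Type*} [Fintype ι] [Fintype κ] :
    (∀ E : HomExpSystem ι κ,
      BddAbove E.nonTorsion.clusterSpans ∧
      E.boundedPairs.Finite ∧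
      {x | E.IsSolution x} = (⋃ p ∈ E.boundedPairs, E.shiftCoset p.1 p.2) ∧
      IsCosetSemilinear {x | E.IsSolution x}) ∧
    (∀ E : ExpSystem ι κ,
      BddAbove E.homogenize.nonTorsion.clusterSpans ∧
      E.boundedPairs.Finite ∧
      {x | E.IsSolution x} = (⋃ p ∈ E.boundedPairs, E.shiftCoset p.1 p.2) ∧
      IsCosetSemilinear {x | E.IsSolution x}) := by
  exact ⟨fun E => ⟨E.bddAbove_clusterSpans_nonTorsion, E.finite_boundedPairs, E.setOf_isSolution,
      E.isCosetSemilinear_setOf_isSolution⟩,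
    fun E => ⟨E.homogenize.bddAbove_clusterSpans_nonTorsion, E.finite_boundedPairs,
      E.setOf_isSolution, E.isCosetSemilinear_setOf_isSolution⟩⟩
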